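/- Let $G$ be a finite simple graph that is 3-colorable and that is obtained from a bipartite graph on the same vertex set by adding $\ell$ edges, where $0\le \ell\le 5$. For a proper coloring of $G$ with colors $1,2,3,4$ (a 4-coloring) and two distinct colors $i,j$, a Kempe change interchanges the colors $i$ and $j$ on one connected component of the subgraph of $G$ induced by all vertices colored $i$ or $j$; two 4-colorings are Kempe equivalent if one is obtained from the other by a finite (possibly empty) sequence of Kempe changes. Then the set of 4-colorings of $G$ forms exactly one Kempe equivalence class; that is, $G$ has a 4-coloring and any two 4-colorings of $G$ are Kempe equivalent. -/

import Mathlib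

namespace SimpleGraph

universe u

variable {V : Type u} {G : SimpleGraph V} {k : ℕ}

/-- `G.IsBipartitePlus l`: the graph `G` is obtained from a bipartite graph `B` on the same vertex
set by adding exactly `l` edges. -/
def IsBipartitePlus (G : SimpleGraph V) (l : ℕ) : Prop :=
  ∃ B : SimpleGraph V, B.IsBipartite ∧ B ≤ G ∧
    (G.edgeSet \ B.edgeSet).Finite ∧ (G.edgeSet \ B.edgeSet).ncard = l

/-- The subgraph of `G` induced by all vertices of colour `i` or `j`. -/
abbrev twoColorSubgraph (c : G.Coloring (Fin k)) (i j : Fin k) :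
    SimpleGraph {v : V | c v = i ∨ c v = j} :=
  G.induce {v : V | c v = i ∨ c v = j}

/-- `IsKempeChange c c'`: the colouring `c'` is obtained from `c` by switching two colours `i`
and `j` on one connected component `D` of the subgraph induced by these two colours. -/
def IsKempeChange (c c' : G.Coloring (Fin k)) : Prop :=
  ∃ i j : Fin k, i ≠ j ∧ ∃ D : (twoColorSubgraph c i j).ConnectedComponent,
    (∀ v ∈ Subtype.val '' D.supp, c' v = Equiv.swap i j (c v)) ∧
    (∀ v ∉ Subtype.val '' D.supp, c' v = c v)

/-- Two colourings are Kempe equivalent if a finite (possibly empty) sequence of Kempe changes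
leads from one to the other. -/
def KempeEquiv (c c' : G.Coloring (Fin k)) : Prop :=
  Relation.ReflTransGen IsKempeChange c c'

theorem exists_component_of_eq {s t : Set V} (h : s = t)
    (D : (G.induce s).ConnectedComponent) :
    ∃ D' : (G.induce t).ConnectedComponent,
      (Subtype.val '' D'.supp : Set V) = Subtype.val '' D.supp := by
  subst h
  exact ⟨D, rfl⟩

theorem IsKempeChange.symm {c c' : G.Coloring (Fin k)} (h : IsKempeChange c c') :
    IsKempeChange c' c := by
  obtain ⟨i, j, hij, D, h1, h2⟩ := h
  have hs : {v : V | c v = i ∨ c v = j} = {v : V | c' v = i ∨ c' v = j} := by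
    ext v
    by_cases hv : v ∈ Subtype.val '' D.supp
    · simp only [Set.mem_ofPred_eq, h1 v hv]
      rw [Equiv.swap_apply_eq_iff, Equiv.swap_apply_eq_iff, Equiv.swap_apply_left,
        Equiv.swap_apply_right]
      exact or_comm
    · simp only [Set.mem_ofPred_eq, h2 v hv]
  obtain ⟨D', hD'⟩ := exists_component_of_eq (G := G) hs D
  refine ⟨i, j, hij, D', ?_, ?_⟩
  · intro v hv
    rw [hD'] at hv
    rw [h1 v hv, Equiv.swap_apply_self]
  · intro v hv
    rw [hD'] at hv
    exact (h2 v hv).symm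

theorem KempeEquiv.symm {c c' : G.Coloring (Fin k)} (h : KempeEquiv c c') : KempeEquiv c' c := by
  unfold KempeEquiv at *
  induction h with
  | refl => exact Relation.ReflTransGen.refl
  | tail _ hbc ih => exact Relation.ReflTransGen.head hbc.symm ih

/-- Kempe equivalence as an equivalence relation on the set of all `k`-colourings of `G`. -/
def kempeSetoid (G : SimpleGraph V) (k : ℕ) : Setoid (G.Coloring (Fin k)) where
  r := KempeEquiv
  iseqv :=
    { refl := fun _ => Relation.ReflTransGen.refl
      symm := fun h => KempeEquiv.symm h
      trans := fun h h' => Relation.ReflTransGen.trans h h' }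

/-- The number of Kempe equivalence classes of `k`-colourings of `G`. -/
noncomputable def kempeClassCount (G : SimpleGraph V) (k : ℕ) : ℕ :=
  Nat.card (Quotient (kempeSetoid G k))

end SimpleGraph

/-! ### Kempe equivalence of colourings that differ in two colours -/

namespace SimpleGraph

/-! Call an edge a same-side edge if both its ends lie on one side of the bipartition; there are at
most five. Four colours form six pairs, so some pair occurs on no same-side edge
(`exists_unused_pair`). Rename that pair 2, 3 and recolour its vertices by side: the other vertices
form a set `P`, properly coloured with 0 and 1, that covers all same-side edges. It remains to reach
one fixed 3-colouring `φ` from any such cover. By `IsAdmissible.kempeRel_of_omits` this is possible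
once some colour of `φ` is absent from the cover, so the task is to move covers until a colour
disappears.

Induction on the size allows `P` to be minimal. Each `p ∈ P` then has a private same-side edge to an
outside vertex `n p`, so `P` has at most five vertices. Up to three vertices are handled by
`IsAdmissible.kempeRel_of_card_le_three`. With four or five, at most one same-side edge is not
private. If none lies inside `P`, the cover is exchanged in one go
(`IsAdmissible.kempeRel_of_consistent`). Otherwise `P` has four vertices and one inner same-side
edge (`IsAdmissible.kempeRel_of_four`): replacing a vertex by its private neighbour can fail only if
`P` induces a path with rigid outside adjacencies (`PathCover`), and the position of the inner edge
on the path decides how to proceed. -/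

/-- Two proper colourings that differ only by exchanging the colours `i` and `j` on some set of
vertices are Kempe equivalent. -/
theorem KempeEquiv.of_differ {V : Type*} [Finite V] {G : SimpleGraph V} {k : ℕ} {i j : Fin k}
    (hij : i ≠ j) (c c' : G.Coloring (Fin k))
    (h : ∀ v, c v ≠ c' v → (c v = i ∧ c' v = j) ∨ (c v = j ∧ c' v = i)) : KempeEquiv c c' := by
  classical
  induction hn : {v | c v ≠ c' v}.ncard using Nat.strong_induction_on generalizing c with
  | _ n ih =>
  by_cases hne : ∃ v, c v ≠ c' v
  swap
  · push Not at hne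
    have : c = c' := DFunLike.ext _ _ hne
    rw [this]
    exact Relation.ReflTransGen.refl
  obtain ⟨v₀, hv₀⟩ := hne
  have hmem : ∀ v, c v ≠ c' v → c v = i ∨ c v = j := fun v hv => by
    rcases h v hv with h | h
    · exact Or.inl h.1
    · exact Or.inr h.1
  let D := (twoColorSubgraph c i j).connectedComponentMk ⟨v₀, hmem v₀ hv₀⟩
  have hswap : ∀ v, c v ≠ c' v → c' v = Equiv.swap i j (c v) := fun v hv => by
    rcases h v hv with ⟨h1, h2⟩ | ⟨h1, h2⟩ <;> simp [h1, h2]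
  -- Disagreement spreads along edges of the two-coloured subgraph: if `w` agreed, one of the two
  -- colourings would give `u` and `w` the same colour. So a single switch settles all of `D`.
  have hD : ∀ w : {v : V | c v = i ∨ c v = j}, w ∈ D.supp → c w ≠ c' w := by
    intro w hw
    have hr : (twoColorSubgraph c i j).Reachable ⟨v₀, hmem v₀ hv₀⟩ w :=
      (ConnectedComponent.eq.mp hw).symm
    rw [reachable_iff_reflTransGen] at hr
    induction hr with
    | refl => exact hv₀
    | @tail u w hu hadj ih2 =>
      have hu' : u ∈ D.supp := by
        rw [ConnectedComponent.mem_supp_iff]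
        exact ConnectedComponent.eq.mpr ((reachable_iff_reflTransGen _ _).mpr hu).symm
      have hd := ih2 hu'
      have ha : G.Adj u w := hadj
      intro he
      have h1 := c.valid ha
      have h2 := c'.valid ha
      rcases h u hd with ⟨a1, a2⟩ | ⟨a1, a2⟩ <;> rcases w.2 with b | b
      · exact h1 (a1.trans b.symm)
      · exact h2 (a2.trans (b.symm.trans he))
      · exact h2 (a2.trans (b.symm.trans he))
      · exact h1 (a1.trans b.symm)
  have hclosed : ∀ u w, G.Adj u w → u ∈ Subtype.val '' D.supp → c w ≠ c' w →
      w ∈ Subtype.val '' D.supp := by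
    rintro _ w ha ⟨u, hu, rfl⟩ hw
    refine ⟨⟨w, hmem w hw⟩, ?_, rfl⟩
    exact ConnectedComponent.mem_supp_of_adj_mem_supp D hu ha
  let c₁ : G.Coloring (Fin k) := Coloring.mk
    (fun v => if v ∈ Subtype.val '' D.supp then c' v else c v) (by
      intro u w ha
      by_cases hu : u ∈ Subtype.val '' D.supp <;> by_cases hw : w ∈ Subtype.val '' D.supp
      · simpa only [hu, hw, if_true] using c'.valid ha
      · simp only [hu, hw, if_true, if_false]
        have : c w = c' w := by
          by_contra hc
          exact hw (hclosed u w ha hu hc)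
        rw [this]
        exact c'.valid ha
      · simp only [hu, hw, if_true, if_false]
        have : c u = c' u := by
          by_contra hc
          exact hu (hclosed w u ha.symm hw hc)
        rw [this]
        exact c'.valid ha
      · simpa only [hu, hw, if_false] using c.valid ha)
  have hc₁ : ∀ v, c₁ v = if v ∈ Subtype.val '' D.supp then c' v else c v := fun _ => rfl
  have hstep : IsKempeChange c c₁ := by
    refine ⟨i, j, hij, D, ?_, ?_⟩
    · rintro v hv
      rw [hc₁, if_pos hv]
      obtain ⟨w, hw, rfl⟩ := hv
      exact hswap _ (hD w hw)
    · intro v hv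
      rw [hc₁, if_neg hv]
  refine Relation.ReflTransGen.head hstep (ih _ ?_ c₁ ?_ rfl)
  · rw [← hn]
    refine Set.ncard_lt_ncard ⟨?_, ?_⟩ (Set.toFinite _)
    · intro v hv
      simp only [Set.mem_ofPred_eq, hc₁] at hv ⊢
      split_ifs at hv
      · exact absurd rfl hv
      · exact hv
    · intro hsub
      have h1 := hsub (show v₀ ∈ {v | c v ≠ c' v} from hv₀)
      have h2 : v₀ ∈ Subtype.val '' D.supp := ⟨⟨v₀, hmem v₀ hv₀⟩, rfl, rfl⟩
      exact h1 (by rw [hc₁]; exact if_pos h2)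
  · intro v hv
    rw [hc₁] at hv ⊢
    split_ifs at hv ⊢
    · exact absurd rfl hv
    · exact h v hv

/-! ### Kempe equivalence for plain colour functions -/

section Reach

variable {V : Type*} {G : SimpleGraph V}

/-- A function is proper if it separates adjacent vertices. -/
def IsProper (G : SimpleGraph V) (a : V → Fin 4) : Prop := ∀ u v, G.Adj u v → a u ≠ a v

/-- Kempe equivalence of two 4-colourings given as plain functions. -/
def KempeRel (G : SimpleGraph V) (a b : V → Fin 4) : Prop :=
  ∃ c c' : G.Coloring (Fin 4), ⇑c = a ∧ ⇑c' = b ∧ KempeEquiv c c'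

theorem KempeRel.trans {a b d : V → Fin 4} (h : KempeRel G a b) (h' : KempeRel G b d) :
    KempeRel G a d := by
  obtain ⟨c₁, c₂, h1, h2, h3⟩ := h
  obtain ⟨c₃, c₄, h4, h5, h6⟩ := h'
  have : c₂ = c₃ := DFunLike.coe_injective (h2.trans h4.symm)
  subst this
  exact ⟨c₁, c₄, h1, h5, Relation.ReflTransGen.trans h3 h6⟩

theorem KempeRel.symm {a b : V → Fin 4} (h : KempeRel G a b) : KempeRel G b a := by
  obtain ⟨c₁, c₂, h1, h2, h3⟩ := h
  exact ⟨c₂, c₁, h2, h1, h3.symm⟩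

theorem KempeRel.of_differ [Finite V] {a b : V → Fin 4} (i j : Fin 4) (hij : i ≠ j)
    (ha : IsProper G a) (hb : IsProper G b)
    (h : ∀ v, a v ≠ b v → (a v = i ∧ b v = j) ∨ (a v = j ∧ b v = i)) : KempeRel G a b :=
  ⟨Coloring.mk a (fun {u v} => ha u v), Coloring.mk b (fun {u v} => hb u v), rfl, rfl,
    KempeEquiv.of_differ hij _ _ h⟩

theorem IsProper.comp_perm {a : V → Fin 4} (ha : IsProper G a) (σ : Equiv.Perm (Fin 4)) :
    IsProper G (σ ∘ a) := fun u v huv h => ha u v huv (σ.injective h)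

theorem KempeRel.swap [Finite V] {a : V → Fin 4} (ha : IsProper G a) (i j : Fin 4) :
    KempeRel G a (Equiv.swap i j ∘ a) := by
  by_cases hij : i = j
  · subst hij
    exact ⟨Coloring.mk a (fun {u v} => ha u v), Coloring.mk a (fun {u v} => ha u v), rfl,
      by ext1 v; simp; rfl, Relation.ReflTransGen.refl⟩
  · refine KempeRel.of_differ i j hij ha (ha.comp_perm _) fun v hv => ?_
    by_cases h1 : a v = i
    · simp [h1]
    · by_cases h2 : a v = j
      · simp [h2]
      · exact absurd (Equiv.swap_apply_of_ne_of_ne h1 h2).symm hv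

end Reach

/-! ### Colourings given by covers of the same-side edges, and moves between covers -/

section Cover

variable {V : Type*} {G : SimpleGraph V} {s f g : V → Bool} {P Q : Finset V}

/-- `P` meets every edge of `G` whose ends lie on the same side of `s`, and `f` is a proper
2-colouring of the subgraph induced by `P`. -/
structure IsAdmissible (G : SimpleGraph V) (s : V → Bool) (P : Finset V) (f : V → Bool) :
    Prop where
  cover : ∀ u v, G.Adj u v → s u = s v → u ∈ P ∨ v ∈ P
  proper : ∀ u ∈ P, ∀ v ∈ P, G.Adj u v → f u ≠ f v

theorem IsAdmissible.mono (h : IsAdmissible G s Q f) (hPQ : P ⊆ Q)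
    (hP : ∀ u v, G.Adj u v → s u = s v → u ∈ P ∨ v ∈ P) : IsAdmissible G s P f :=
  ⟨hP, fun u hu v hv => h.proper u (hPQ hu) v (hPQ hv)⟩

variable [DecidableEq V]

/-- The colouring with colours `0, 1` on `P` according to `f`, and `2, 3` elsewhere according
to the side `s`. -/
def coverColor (s : V → Bool) (P : Finset V) (f : V → Bool) (v : V) : Fin 4 :=
  if v ∈ P then (if f v then 1 else 0) else (if s v then 3 else 2)

theorem coverColor_of_mem {v : V} (hv : v ∈ P) :
    coverColor s P f v = if f v then 1 else 0 := if_pos hv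

theorem coverColor_of_notMem {v : V} (hv : v ∉ P) :
    coverColor s P f v = if s v then 3 else 2 := if_neg hv

theorem IsAdmissible.isProper (h : IsAdmissible G s P f) : IsProper G (coverColor s P f) := by
  intro u v huv
  have h1 := h.cover u v huv
  have h2 := h.proper u
  unfold coverColor
  by_cases hu : u ∈ P <;> by_cases hv : v ∈ P <;> simp only [hu, hv, if_true, if_false]
  · have := h2 hu v hv huv
    cases hfu : f u <;> cases hfv : f v <;> simp_all
  · cases f u <;> cases s v <;> decide
  · cases f v <;> cases s u <;> decide
  · cases hfu : s u <;> cases hfv : s v <;> simp_all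

variable [Finite V]

theorem IsAdmissible.kempeRel_of_twoColoring (hf : IsAdmissible G s P f)
    (hg : IsAdmissible G s P g) : KempeRel G (coverColor s P f) (coverColor s P g) := by
  refine KempeRel.of_differ 0 1 (by decide) hf.isProper hg.isProper fun v hv => ?_
  unfold coverColor at hv ⊢
  by_cases hvP : v ∈ P
  · simp only [hvP, if_true] at hv ⊢
    cases hfv : f v <;> cases hgv : g v <;> simp_all
  · simp [hvP] at hv

theorem IsAdmissible.refl (hf : IsAdmissible G s P f) :
    KempeRel G (coverColor s P f) (coverColor s P f) :=
  hf.kempeRel_of_twoColoring hf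

/-- Enlarging the cover inside an admissible set does not change the Kempe class. -/
theorem IsAdmissible.kempeRel_of_subset (h : IsAdmissible G s Q f) (hPQ : P ⊆ Q)
    (hP : IsAdmissible G s P g) : KempeRel G (coverColor s P g) (coverColor s Q f) := by
  have hP' : IsAdmissible G s P f := h.mono hPQ hP.cover
  refine (hP.kempeRel_of_twoColoring hP').trans ?_
  -- Vertices are added one at a time: each step recolours at most one vertex, and every
  -- intermediate set is a cover on which `f` is proper.
  have key : ∀ T : Finset V, P ∪ T ⊆ Q →
      KempeRel G (coverColor s P f) (coverColor s (P ∪ T) f) := by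
    intro T
    induction T using Finset.induction_on with
    | empty => intro _; simpa using hP'.refl
    | insert v T hv ih =>
      intro hsub
      have e : P ∪ insert v T = insert v (P ∪ T) := by ext; simp
      have hsub' : P ∪ T ⊆ Q := fun x hx => hsub (by rw [e]; exact Finset.mem_insert_of_mem hx)
      have cov : ∀ R : Finset V, P ⊆ R → ∀ u v, G.Adj u v → s u = s v → u ∈ R ∨ v ∈ R :=
        fun R hR u v h1 h2 => (hP.cover u v h1 h2).imp (@hR _) (@hR _)
      have a1 : IsAdmissible G s (P ∪ T) f := h.mono hsub' (cov _ Finset.subset_union_left)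
      have a2 : IsAdmissible G s (P ∪ insert v T) f := h.mono hsub (cov _ Finset.subset_union_left)
      refine (ih hsub').trans ?_
      by_cases he : coverColor s (P ∪ T) f v = coverColor s (P ∪ insert v T) f v
      · have : coverColor s (P ∪ T) f = coverColor s (P ∪ insert v T) f := by
          funext w
          by_cases hw : w = v
          · rw [hw, he]
          · simp [coverColor, hw]
        rw [← this]
        exact a1.refl
      · refine KempeRel.of_differ _ _ he a1.isProper a2.isProper fun w hw => ?_
        have : w = v := by
          by_contra hwv
          exact hw (by simp [coverColor, hwv])
        subst this
        exact Or.inl ⟨rfl, rfl⟩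
  have := key (Q \ P) (by rw [Finset.union_sdiff_of_subset hPQ])
  rwa [Finset.union_sdiff_of_subset hPQ] at this

/-- Replacing a vertex `x` of the cover by its outside neighbours `N` on the same side. -/
theorem IsAdmissible.replace (h : IsAdmissible G s P f) {x : V} (hx : x ∈ P) {N : Finset V}
    (hN : ∀ w, w ∈ N ↔ w ∉ P ∧ G.Adj x w ∧ s x = s w)
    (hfree : ∀ w ∈ N, ∀ u ∈ P, u ≠ x → f u = f x → ¬ G.Adj w u) :
    ∃ f', IsAdmissible G s (P.erase x ∪ N) f' ∧
      KempeRel G (coverColor s P f) (coverColor s (P.erase x ∪ N) f') := by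
  have hxN : x ∉ N := fun hc => ((hN x).1 hc).1 hx
  -- Vertices of `N` share a side and lie outside `P`, so they are pairwise nonadjacent and can all
  -- take the colour that `x` gives up. The move exchanges only that colour and the colour of the
  -- side of `x`.
  have ha : IsAdmissible G s (P.erase x ∪ N) (fun v => if v ∈ N then f x else f v) := by
    constructor
    · intro u v huv hs
      by_contra! hc
      simp only [Finset.mem_union, Finset.mem_erase, not_or, not_and] at hc
      obtain ⟨⟨hu1, hu2⟩, hv1, hv2⟩ := hc
      rcases h.cover u v huv hs with hu | hv
      · have : u = x := by by_contra hne; exact hu1 hne hu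
        subst this
        by_cases hv : v ∈ P
        · exact hv1 huv.ne' hv
        · exact hv2 ((hN v).2 ⟨hv, huv, hs⟩)
      · have : v = x := by by_contra hne; exact hv1 hne hv
        subst this
        by_cases hu : u ∈ P
        · exact hu1 huv.ne hu
        · exact hu2 ((hN u).2 ⟨hu, huv.symm, hs.symm⟩)
    · intro u hu v hv huv
      have huP : u ∉ N → u ∈ P ∧ u ≠ x := fun hn => by
        simp only [Finset.mem_union, hn, or_false, Finset.mem_erase] at hu
        exact ⟨hu.2, hu.1⟩
      have hvP : v ∉ N → v ∈ P ∧ v ≠ x := fun hn => by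
        simp only [Finset.mem_union, hn, or_false, Finset.mem_erase] at hv
        exact ⟨hv.2, hv.1⟩
      by_cases hu' : u ∈ N <;> by_cases hv' : v ∈ N <;> simp only [hu', hv', if_true, if_false]
      · have h1 := (hN u).1 hu'
        have h2 := (hN v).1 hv'
        rcases h.cover u v huv (h1.2.2.symm.trans h2.2.2) with h3 | h3
        · exact absurd h3 h1.1
        · exact absurd h3 h2.1
      · exact fun he => hfree u hu' v (hvP hv').1 (hvP hv').2 he.symm huv
      · exact fun he => hfree v hv' u (huP hu').1 (huP hu').2 he huv.symm
      · exact h.proper u (huP hu').1 v (hvP hv').1 huv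
  refine ⟨_, ha, KempeRel.of_differ (if f x then 1 else 0) (if s x then 3 else 2) ?_
    h.isProper ha.isProper fun v hv => ?_⟩
  · cases f x <;> cases s x <;> decide
  · by_cases hvx : v = x
    · subst hvx
      left
      simp [coverColor, hx, hxN]
    · by_cases hvN : v ∈ N
      · right
        have := (hN v).1 hvN
        simp [coverColor, hvN, this.1, this.2.2]
      · exact absurd (by simp [coverColor, hvx, hvN]) hv

/-- Replacing a vertex `x` of the cover by its only outside neighbour `y` on the same side. -/
theorem IsAdmissible.replace_single (h : IsAdmissible G s P f) {x y : V} (hx : x ∈ P)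
    (hy : ∀ w, w ∉ P ∧ G.Adj x w ∧ s x = s w ↔ w = y)
    (hfree : (∀ u ∈ P, u ≠ x → f u = f x → ¬ G.Adj y u) ∨ (∀ u ∈ P, f u ≠ f x → ¬ G.Adj y u)) :
    ∃ f', IsAdmissible G s (insert y (P.erase x)) f' ∧
      KempeRel G (coverColor s P f) (coverColor s (insert y (P.erase x)) f') := by
  have e : insert y (P.erase x) = P.erase x ∪ {y} := by ext; simp
  have hN : ∀ w, w ∈ ({y} : Finset V) ↔ w ∉ P ∧ G.Adj x w ∧ s x = s w := by
    intro w; rw [hy]; simp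
  obtain ⟨hyP, hxy, hsxy⟩ := (hy y).2 rfl
  rcases hfree with hfree | hfree
  · rw [e]
    exact h.replace hx hN (by simpa using hfree)
  · have hne : ∀ v ∈ P, v ≠ y := fun v hv hc => hyP (hc ▸ hv)
    -- Here `y` takes the colour opposite to that of `x`, so the change is not one two-colour
    -- exchange; it passes through the cover containing both `x` and `y`.
    have hbig : IsAdmissible G s (insert y P) (fun v => if v = y then !(f x) else f v) := by
      constructor
      · intro u v huv hs
        exact (h.cover u v huv hs).imp Finset.mem_insert_of_mem Finset.mem_insert_of_mem
      · intro u hu v hv huv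
        rcases Finset.mem_insert.1 hu with rfl | hu' <;>
          rcases Finset.mem_insert.1 hv with rfl | hv'
        · exact absurd rfl huv.ne
        · simp only [hne v hv', if_true, if_false]
          intro hc
          refine hfree v hv' ?_ huv
          rw [← hc]; simp
        · simp only [hne u hu', if_true, if_false]
          intro hc
          refine hfree u hu' ?_ huv.symm
          rw [hc]; simp
        · simp only [hne u hu', hne v hv', if_false]
          exact h.proper u hu' v hv' huv
    have hsmall : IsAdmissible G s (insert y (P.erase x))
        (fun v => if v = y then !(f x) else f v) := by
      refine hbig.mono (Finset.insert_subset_insert _ (Finset.erase_subset _ _)) ?_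
      intro u v huv hs
      by_contra! hc
      simp only [Finset.mem_insert, Finset.mem_erase, not_or, not_and] at hc
      obtain ⟨⟨hu1, hu2⟩, hv1, hv2⟩ := hc
      rcases h.cover u v huv hs with hu | hv
      · have : u = x := by by_contra hne; exact hu2 hne hu
        subst this
        exact hv1 ((hy v).1 ⟨fun hv => hv2 huv.ne' hv, huv, hs⟩)
      · have : v = x := by by_contra hne; exact hv2 hne hv
        subst this
        exact hu1 ((hy u).1 ⟨fun hu => hu2 huv.ne hu, huv.symm, hs.symm⟩)
    refine ⟨_, hsmall, ?_⟩
    exact (hbig.kempeRel_of_subset (Finset.subset_insert _ _) h).trans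
      (hbig.kempeRel_of_subset (Finset.insert_subset_insert _ (Finset.erase_subset _ _))
        hsmall).symm

/-- Two covers that contain no edge inside a side give Kempe equivalent colourings. -/
theorem IsAdmissible.kempeRel_of_side (hP : IsAdmissible G s P s) (hQ : IsAdmissible G s Q s) :
    KempeRel G (coverColor s P s) (coverColor s Q s) := by
  -- Same-side edges on the two sides do not interact, so `P` can serve one side and `Q` the other.
  -- Each half of the change then uses only the colours 0, 2 or only 1, 3.
  let R : Finset V := (P.filter fun v => s v = true) ∪ (Q.filter fun v => s v = false)
  have hR1 : ∀ v, s v = true → (v ∈ R ↔ v ∈ P) := fun v hv => by simp [R, hv]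
  have hR2 : ∀ v, s v = false → (v ∈ R ↔ v ∈ Q) := fun v hv => by simp [R, hv]
  have hR : IsAdmissible G s R s := by
    constructor
    · intro u v huv hs
      cases hv : s v
      · rw [hR2 u (hs.trans hv), hR2 v hv]
        exact hQ.cover u v huv hs
      · rw [hR1 u (hs.trans hv), hR1 v hv]
        exact hP.cover u v huv hs
    · intro u hu v hv huv hs
      cases hv' : s v
      · rw [hR2 u (hs.trans hv')] at hu
        rw [hR2 v hv'] at hv
        exact hQ.proper u hu v hv huv hs
      · rw [hR1 u (hs.trans hv')] at hu
        rw [hR1 v hv'] at hv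
        exact hP.proper u hu v hv huv hs
  have h1 : KempeRel G (coverColor s P s) (coverColor s R s) := by
    refine KempeRel.of_differ 0 2 (by decide) hP.isProper hR.isProper fun v hv => ?_
    unfold coverColor at hv ⊢
    cases hs : s v
    · by_cases h1 : v ∈ P <;> by_cases h2 : v ∈ R <;> simp_all
    · simp [hR1 v hs] at hv
  have h2 : KempeRel G (coverColor s R s) (coverColor s Q s) := by
    refine KempeRel.of_differ 1 3 (by decide) hR.isProper hQ.isProper fun v hv => ?_
    unfold coverColor at hv ⊢
    cases hs : s v
    · simp [hR2 v hs] at hv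
    · by_cases h1 : v ∈ Q <;> by_cases h2 : v ∈ R <;> simp_all
  exact h1.trans h2

/-- A 3-colouring as a 4-colouring. -/
def castColor (φ : V → Fin 3) (v : V) : Fin 4 := (φ v).castSucc

/-- If a 3-colouring `φ` omits a colour on the cover, then the colouring of the cover is Kempe
equivalent to `φ`. -/
theorem IsAdmissible.kempeRel_of_omits (h : IsAdmissible G s P f) {φ : V → Fin 3}
    (hφ : ∀ u v, G.Adj u v → φ u ≠ φ v) {i : Fin 3} (hi : ∀ v ∈ P, φ v ≠ i) :
    KempeRel G (coverColor s P f) (castColor φ) := by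
  have hΦ : IsProper G (castColor φ) := fun u v huv hc =>
    hφ u v huv (Fin.castSucc_injective _ hc)
  -- The swap names the omitted colour 2. As `castColor φ` never uses 3, the other two classes get 0
  -- and 1 and form an enlarged cover; outside it, 2 and 3 are merged.
  let c₀ : V → Fin 4 := Equiv.swap i.castSucc 2 ∘ castColor φ
  have hc₀ : IsProper G c₀ := hΦ.comp_perm _
  have hrel : KempeRel G (castColor φ) c₀ := KempeRel.swap hΦ _ _
  have hval : ∀ v, c₀ v = Equiv.swap i.castSucc 2 (φ v).castSucc := fun _ => rfl
  have h2 : ∀ a b : Fin 3, a = b ↔ Equiv.swap b.castSucc (2 : Fin 4) a.castSucc = 2 := by decide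
  have h3 : ∀ a b : Fin 3, Equiv.swap b.castSucc (2 : Fin 4) a.castSucc ≠ 3 := by decide
  have := Fintype.ofFinite V
  let R : Finset V := Finset.univ.filter fun v => φ v ≠ i
  let g : V → Bool := fun v => decide (c₀ v = 1)
  have hRmem : ∀ v, v ∈ R ↔ c₀ v ≠ 2 := fun v => by simp [R, hval, ← h2]
  have hR3 : ∀ v, c₀ v ≠ 3 := fun v => h3 _ _
  have hPR : P ⊆ R := fun v hv => by simpa [R] using hi v hv
  have hfin : ∀ a : Fin 4, a ≠ 2 → a ≠ 3 → a = 0 ∨ a = 1 := by decide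
  have hR : IsAdmissible G s R g := by
    refine ⟨fun u v h1 h2 => (h.cover u v h1 h2).imp (@hPR _) (@hPR _), ?_⟩
    intro u hu v hv huv
    have := hc₀ u v huv
    rw [hRmem] at hu hv
    rcases hfin _ hu (hR3 u) with e | e <;> rcases hfin _ hv (hR3 v) with e' | e' <;>
      simp_all [g]
  have hlast : KempeRel G (coverColor s R g) c₀ := by
    refine KempeRel.of_differ 2 3 (by decide) hR.isProper hc₀ fun v hv => ?_
    by_cases hvR : v ∈ R
    · exfalso
      apply hv
      rw [coverColor_of_mem hvR]
      rcases hfin _ ((hRmem v).1 hvR) (hR3 v) with e | e <;> simp [g, e]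
    · have e : c₀ v = 2 := by
        by_contra hc
        exact hvR ((hRmem v).2 hc)
      rw [coverColor_of_notMem hvR, e] at *
      cases hs : s v <;> simp_all
  exact ((hR.kempeRel_of_subset hPR h).trans hlast).trans hrel.symm

end Cover

/-! ### Covers from which a colour can be removed directly -/

section Replace

theorem bool_eq_of_ne {x y z : Bool} (h1 : x ≠ y) (h2 : z ≠ y) : x = z := by
  cases x <;> cases y <;> cases z <;> simp_all

variable {V : Type*} [DecidableEq V] [Finite V] {G : SimpleGraph V} {s f : V → Bool}
  {φ : V → Fin 3} {P : Finset V}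

/-- Since `f a = f b`, the vertex `x` can take the opposite value. No other cover vertex then shares
it, so `x` can be traded for its outside same-side neighbours, and the new cover omits `φ x`. -/
theorem IsAdmissible.kempeRel_of_triple {x a b : V}
    (h : IsAdmissible G s {x, a, b} f) (hφ : ∀ u v, G.Adj u v → φ u ≠ φ v)
    (hxa : φ a ≠ φ x) (hxb : φ b ≠ φ x) (hab : f a = f b) :
    KempeRel G (coverColor s {x, a, b} f) (castColor φ) := by
  classical
  have := Fintype.ofFinite V
  have hax : a ≠ x := fun e => hxa (e ▸ rfl)
  have hbx : b ≠ x := fun e => hxb (e ▸ rfl)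
  have hg : IsAdmissible G s {x, a, b} (fun v => if v = x then !(f a) else f v) := by
    refine ⟨h.cover, fun u hu v hv huv => ?_⟩
    have h1 := h.proper u hu v hv huv
    have h2 := huv.ne
    simp only [Finset.mem_insert, Finset.mem_singleton] at hu hv
    rcases hu with rfl | rfl | rfl <;> rcases hv with rfl | rfl | rfl <;> simp_all
  obtain ⟨f', ha, hr⟩ := hg.replace (x := x) (by simp)
    (N := Finset.univ.filter fun w => w ∉ ({x, a, b} : Finset V) ∧ G.Adj x w ∧ s x = s w)
    (fun w => by simp) (by
      intro w _ u hu hux hfu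
      simp only [Finset.mem_insert, Finset.mem_singleton] at hu
      rcases hu with rfl | rfl | rfl
      · exact absurd rfl hux
      · simp [hax] at hfu
      · simp [hbx, hab] at hfu)
  refine (h.kempeRel_of_twoColoring hg).trans (hr.trans (ha.kempeRel_of_omits hφ (i := φ x) ?_))
  intro v hv
  simp only [Finset.mem_union, Finset.mem_erase, Finset.mem_insert, Finset.mem_singleton,
    Finset.mem_filter, Finset.mem_univ, true_and] at hv
  rcases hv with ⟨h1, h2 | h2 | h2⟩ | ⟨_, h2, _⟩
  · exact absurd h2 h1
  · rwa [h2]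
  · rwa [h2]
  · exact (hφ _ _ h2).symm

theorem exists_fin_three_ne (a b : Fin 3) : ∃ i, a ≠ i ∧ b ≠ i := by
  revert a b; decide

/-- A cover with at most three vertices leads to the given 3-colouring. -/
theorem IsAdmissible.kempeRel_of_card_le_three (h : IsAdmissible G s P f)
    (hφ : ∀ u v, G.Adj u v → φ u ≠ φ v) (hP : P.card ≤ 3) :
    KempeRel G (coverColor s P f) (castColor φ) := by
  have two : ∀ i j, (∀ v ∈ P, φ v = i ∨ φ v = j) →
      KempeRel G (coverColor s P f) (castColor φ) := fun i j hij => by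
    obtain ⟨k, hi, hj⟩ := exists_fin_three_ne i j
    refine h.kempeRel_of_omits hφ (i := k) fun v hv => ?_
    rcases hij v hv with e | e <;> rwa [e]
  interval_cases hc : P.card
  · rw [Finset.card_eq_zero] at hc
    exact two 0 0 (by simp [hc])
  · obtain ⟨a, rfl⟩ := Finset.card_eq_one.1 hc
    exact two (φ a) (φ a) (by simp)
  · obtain ⟨a, b, _, rfl⟩ := Finset.card_eq_two.1 hc
    exact two (φ a) (φ b) (by simp)
  · obtain ⟨a, b, c, _, _, _, rfl⟩ := Finset.card_eq_three.1 hc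
    by_cases h1 : φ a = φ b
    · exact two (φ a) (φ c) (by simp [h1])
    by_cases h2 : φ a = φ c
    · exact two (φ a) (φ b) (by simp [h2])
    by_cases h3 : φ b = φ c
    · exact two (φ a) (φ b) (by simp [h3])
    -- Two of the three vertices agree under `f`; the remaining one plays the role of `x`.
    by_cases e1 : f b = f c
    · exact h.kempeRel_of_triple hφ (Ne.symm h1) (Ne.symm h2) e1
    by_cases e2 : f a = f c
    · have : ({a, b, c} : Finset V) = {b, a, c} := by ext; simp; tauto
      rw [this] at h ⊢
      exact h.kempeRel_of_triple hφ h1 (Ne.symm h3) e2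
    · have e3 : f a = f b := bool_eq_of_ne e2 e1
      have : ({a, b, c} : Finset V) = {c, a, b} := by ext; simp; tauto
      rw [this] at h ⊢
      exact h.kempeRel_of_triple hφ h2 h3 e3

/-- If the cover contains no edge inside a side and the colour `i` is consistent on the outside
neighbours of each of its vertices, then it leads to the given 3-colouring. -/
theorem IsAdmissible.kempeRel_of_consistent (h : IsAdmissible G s P s)
    (hφ : ∀ u v, G.Adj u v → φ u ≠ φ v) (n : V → V) (hn : ∀ p ∈ P, G.Adj p (n p)) (i : Fin 3)
    (hi : ∀ p ∈ P, ∀ w, G.Adj p w → s p = s w → (φ w = i ↔ φ (n p) = i)) :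
    KempeRel G (coverColor s P s) (castColor φ) := by
  classical
  have := Fintype.ofFinite V
  -- `Q` contains exactly one end of each same-side edge: the outside end unless it has colour `i`,
  -- and in that case, by consistency, the end in `P`. A vertex of `P` enters only with a neighbour
  -- of colour `i`, so `Q` omits `i`.
  let Q : Finset V := Finset.univ.filter fun v =>
    (v ∉ P ∧ φ v ≠ i) ∨ (v ∈ P ∧ φ (n v) = i)
  have hQ : ∀ v, v ∈ Q ↔ (v ∉ P ∧ φ v ≠ i) ∨ (v ∈ P ∧ φ (n v) = i) := fun v => by simp [Q]
  have hcase : ∀ u v, G.Adj u v → s u = s v → (u ∈ P ∧ v ∉ P) ∨ (u ∉ P ∧ v ∈ P) := by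
    intro u v huv hs
    have h1 := h.cover u v huv hs
    have h2 : u ∈ P → v ∈ P → False := fun hu hv => h.proper u hu v hv huv hs
    tauto
  have hQa : IsAdmissible G s Q s := by
    constructor
    · intro u v huv hs
      rw [hQ, hQ]
      rcases hcase u v huv hs with ⟨h1, h2⟩ | ⟨h1, h2⟩
      · have := hi u h1 v huv hs
        tauto
      · have := hi v h2 u huv.symm hs.symm
        tauto
    · intro u hu v hv huv hs
      rw [hQ] at hu hv
      rcases hcase u v huv hs with ⟨h1, h2⟩ | ⟨h1, h2⟩
      · have := hi u h1 v huv hs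
        tauto
      · have := hi v h2 u huv.symm hs.symm
        tauto
  refine (h.kempeRel_of_side hQa).trans (hQa.kempeRel_of_omits hφ (i := i) fun v hv => ?_)
  rcases (hQ v).1 hv with ⟨_, h2⟩ | ⟨h1, h2⟩
  · exact h2
  · rw [← h2]
    exact hφ _ _ (hn v h1)

end Replace

theorem fin_three_eq {a b c d : Fin 3} (h1 : a ≠ b) (h2 : a ≠ c) (h3 : b ≠ c) (h4 : d ≠ a)
    (h5 : d ≠ b) : d = c := by omega

/-! ### Four-vertex covers that induce a path -/

section Path

variable {V : Type*} [DecidableEq V]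

/-- A cover that induces a path `a v u b`, where every vertex `p` of the cover has exactly one
neighbour `n p` outside of it on the same side, the outside neighbours of `u` and `v` are adjacent
to `a` and `b`, and at most one edge of the path lies inside a side. -/
structure PathCover (G : SimpleGraph V) (s : V → Bool) (φ : V → Fin 3) (P : Finset V)
    (f : V → Bool) (n : V → V) (a v u b : V) : Prop where
  adm : IsAdmissible G s P f
  col : ∀ u v, G.Adj u v → φ u ≠ φ v
  eq : P = {a, v, u, b}
  hab : a ≠ b
  hav : G.Adj a v
  hvu : G.Adj v u
  hub : G.Adj u b
  fau : f a = f u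
  fvb : f v = f b
  φab : φ a = φ b
  out : ∀ p ∈ P, n p ∉ P ∧ G.Adj p (n p) ∧ s p = s (n p)
  mono : ∀ p q, G.Adj p q → s p = s q →
    (p ∈ P ∧ q = n p) ∨ (q ∈ P ∧ p = n q) ∨ (p ∈ P ∧ q ∈ P)
  uniq : ∀ p ∈ P, ∀ q ∈ P, ∀ p' ∈ P, ∀ q' ∈ P, G.Adj p q → s p = s q → G.Adj p' q' →
    s p' = s q' → s(p, q) = s(p', q')
  nua : G.Adj (n u) a
  nub : G.Adj (n u) b
  nva : G.Adj (n v) a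
  nvb : G.Adj (n v) b

namespace PathCover

variable {G : SimpleGraph V} {s : V → Bool} {φ : V → Fin 3} {P : Finset V} {f : V → Bool}
  {n : V → V} {a v u b : V}

theorem reverse (h : PathCover G s φ P f n a v u b) : PathCover G s φ P f n b u v a where
  adm := h.adm
  col := h.col
  eq := by rw [h.eq]; ext; simp; tauto
  hab := h.hab.symm
  hav := h.hub.symm
  hvu := h.hvu.symm
  hub := h.hav.symm
  fau := h.fvb.symm
  fvb := h.fau.symm
  φab := h.φab.symm
  out := h.out
  mono := h.mono
  uniq := h.uniq
  nua := h.nvb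
  nub := h.nva
  nva := h.nub
  nvb := h.nua

theorem mem (h : PathCover G s φ P f n a v u b) : a ∈ P ∧ v ∈ P ∧ u ∈ P ∧ b ∈ P := by
  rw [h.eq]; simp

theorem unique_out (h : PathCover G s φ P f n a v u b) {p : V} (hp : p ∈ P) (w : V) :
    w ∉ P ∧ G.Adj p w ∧ s p = s w ↔ w = n p := by
  constructor
  · rintro ⟨h1, h2, h3⟩
    rcases h.mono p w h2 h3 with h4 | h4 | h4
    · exact h4.2
    · exact absurd h4.1 h1
    · exact absurd h4.2 h1
  · rintro rfl
    exact h.out p hp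

theorem φu_ne (h : PathCover G s φ P f n a v u b) : φ a ≠ φ u := by
  rw [h.φab]; exact (h.col _ _ h.hub).symm

/-- The neighbours `a` and `u` of `n u` exclude every other colour. -/
theorem φnu (h : PathCover G s φ P f n a v u b) : φ (n u) = φ v :=
  fin_three_eq h.φu_ne (h.col _ _ h.hav) (h.col _ _ h.hvu).symm
    (h.col _ _ h.nua) (h.col _ _ (h.out u h.mem.2.2.1).2.1).symm

theorem fne (h : PathCover G s φ P f n a v u b) : f v ≠ f u :=
  h.adm.proper v h.mem.2.1 u h.mem.2.2.1 h.hvu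

variable [Finite V]

/-- The edges `av` and `vu` cross sides, so `a`, `u`, `b` share a side, and uniqueness of outside
neighbours forces `n a = n u = n b`. This vertex has colour `φ v`, so it can replace `b`. It also
covers the private edge of `a`, which leaves the three-vertex cover `u`, `v`, `n b`. -/
theorem kempeRel_of_end (h : PathCover G s φ P f n a v u b) (hs : s u = s b) :
    KempeRel G (coverColor s P f) (castColor φ) := by
  obtain ⟨ha, hv, hu, hb⟩ := h.mem
  have hau : a ≠ u := fun e => h.φu_ne (e ▸ rfl)
  have hvb : v ≠ b := fun e => h.col _ _ h.hav (by rw [h.φab, e])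
  have hav : s a ≠ s v := fun e => by
    have := h.uniq a ha v hv u hu b hb h.hav e h.hub hs
    simp only [Sym2.eq_iff] at this
    rcases this with ⟨e, _⟩ | ⟨e, _⟩
    · exact hau e
    · exact h.hab e
  have hvu : s v ≠ s u := fun e => by
    have := h.uniq v hv u hu u hu b hb h.hvu e h.hub hs
    simp only [Sym2.eq_iff] at this
    rcases this with ⟨e, _⟩ | ⟨e, _⟩
    · exact h.hvu.ne e
    · exact hvb e
  have hsau : s a = s u := bool_eq_of_ne hav hvu.symm
  obtain ⟨o1, o2, o3⟩ := h.out u hu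
  have ena : n u = n a := (h.unique_out ha (n u)).1 ⟨o1, h.nua.symm, hsau.trans o3⟩
  have enb : n u = n b := (h.unique_out hb (n u)).1 ⟨o1, h.nub.symm, hs.symm.trans o3⟩
  obtain ⟨f', hf', hr⟩ := h.adm.replace_single hb (h.unique_out hb) (Or.inl (by
    intro w hw hwb hfw
    rw [h.eq] at hw
    simp only [Finset.mem_insert, Finset.mem_singleton] at hw
    rw [← enb]
    intro hadj
    rcases hw with rfl | rfl | rfl | rfl
    · exact h.fne (h.fvb.trans (hfw.symm.trans h.fau))
    · exact h.col _ _ hadj h.φnu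
    · exact h.fne (h.fvb.trans hfw.symm)
    · exact hwb rfl))
  have hsub : ({u, v, n b} : Finset V) ⊆ insert (n b) (P.erase b) := by
    intro w hw
    simp only [Finset.mem_insert, Finset.mem_singleton] at hw
    rcases hw with rfl | rfl | rfl
    · simp [hu, h.hub.ne]
    · simp [hv, hvb]
    · simp
  have hthree : IsAdmissible G s {u, v, n b} f' := by
    refine hf'.mono hsub ?_
    have hone : ∀ p ∈ P, p ∈ ({u, v, n b} : Finset V) ∨ n p ∈ ({u, v, n b} : Finset V) := by
      intro p hp
      rw [h.eq] at hp
      simp only [Finset.mem_insert, Finset.mem_singleton] at hp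
      rcases hp with rfl | rfl | rfl | rfl
      · right; simp [← enb, ← ena]
      · left; simp
      · left; simp
      · right; simp
    intro p q hpq hspq
    rcases h.mono p q hpq hspq with ⟨h1, rfl⟩ | ⟨h1, rfl⟩ | ⟨h1, h2⟩
    · exact hone p h1
    · exact (hone q h1).symm
    · have := h.uniq p h1 q h2 u hu b hb hpq hspq h.hub hs
      simp only [Sym2.eq_iff] at this
      rcases this with ⟨e, _⟩ | ⟨_, e⟩
      · left; simp [e]
      · right; simp [e]
  exact hr.trans ((hf'.kempeRel_of_subset hsub hthree).symm.trans
    (hthree.kempeRel_of_card_le_three h.col Finset.card_le_three))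

/-- Once `n a` has replaced `a`, its colour is `φ u` or `φ v`. Replacing `v` or `u` respectively by
its outside neighbour then removes the colour of the replaced vertex from the cover. -/
theorem kempeRel_of_middle_of_free (h : PathCover G s φ P f n a v u b) (hs : s v = s u)
    (hfree : ¬ G.Adj (n a) u ∨ (¬ G.Adj (n a) v ∧ ¬ G.Adj (n a) b)) :
    KempeRel G (coverColor s P f) (castColor φ) := by
  obtain ⟨ha, hv, hu, hb⟩ := h.mem
  have hau : a ≠ u := fun e => h.φu_ne (e ▸ rfl)
  have hvb : v ≠ b := fun e => h.col _ _ h.hav (by rw [h.φab, e])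
  have hav : s a ≠ s v := fun e => by
    have := h.uniq a ha v hv v hv u hu h.hav e h.hvu hs
    simp only [Sym2.eq_iff] at this
    rcases this with ⟨e, _⟩ | ⟨e, _⟩
    · exact h.hav.ne e
    · exact hau e
  obtain ⟨f₁, hf₁, hr⟩ := h.adm.replace_single ha (h.unique_out ha) (by
    refine hfree.imp (fun hf w hw hwa hfw => ?_) (fun hf w hw hfw => ?_) <;>
    · rw [h.eq] at hw
      simp only [Finset.mem_insert, Finset.mem_singleton] at hw
      have := h.fne
      have := h.fau
      have := h.fvb
      rcases hw with rfl | rfl | rfl | rfl <;> simp_all)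
  -- Here `p` is the middle vertex to be replaced, and `q` is the other one, whose colour `n a` and
  -- `n p` share.
  have key : ∀ p q, (p = v ∧ q = u) ∨ (p = u ∧ q = v) → φ (n a) = φ q → φ (n p) = φ q →
      KempeRel G (coverColor s P f) (castColor φ) := by
    intro p q hpq hq hnp
    have hp : p ∈ P := by rcases hpq with ⟨rfl, _⟩ | ⟨rfl, _⟩ <;> assumption
    have hpa : p ≠ a := by
      rcases hpq with ⟨rfl, _⟩ | ⟨rfl, _⟩
      · exact h.hav.ne'
      · exact hau.symm
    have hsp : s a ≠ s p := by
      rcases hpq with ⟨rfl, _⟩ | ⟨rfl, _⟩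
      · exact hav
      · rwa [← hs]
    have hφpq : φ q ≠ φ p := by
      rcases hpq with ⟨rfl, rfl⟩ | ⟨rfl, rfl⟩
      · exact (h.col _ _ h.hvu).symm
      · exact h.col _ _ h.hvu
    have hφb : φ b ≠ φ p := by
      rcases hpq with ⟨rfl, rfl⟩ | ⟨rfl, rfl⟩
      · rw [← h.φab]; exact h.col _ _ h.hav
      · exact (h.col _ _ h.hub).symm
    have hmem : ∀ w ∈ insert (n a) (P.erase a), w = n a ∨ w = p ∨ w = q ∨ w = b := by
      intro w hw
      rw [h.eq] at hw
      simp only [Finset.mem_insert, Finset.mem_singleton, Finset.mem_erase] at hw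
      rcases hpq with ⟨rfl, rfl⟩ | ⟨rfl, rfl⟩ <;> tauto
    have hpn : p ≠ n a := fun e => (h.out a ha).1 (e ▸ hp)
    obtain ⟨f₂, hf₂, hr₂⟩ := hf₁.replace_single (x := p) (y := n p) (by simp [hp, hpa]) (by
      intro w
      constructor
      · rintro ⟨h1, h2, h3⟩
        refine (h.unique_out hp w).1 ⟨fun hw => h1 ?_, h2, h3⟩
        have : w ≠ a := fun e => hsp (e ▸ h3.symm)
        simp [this, hw]
      · rintro rfl
        obtain ⟨o1, o2, o3⟩ := h.out p hp
        refine ⟨fun hw => ?_, o2, o3⟩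
        simp only [Finset.mem_insert, Finset.mem_erase] at hw
        rcases hw with hw | hw
        · exact hsp ((h.out a ha).2.2.trans (hw ▸ o3.symm))
        · exact o1 hw.2) (by
      -- Apart from `p`, only `b` can be a cover neighbour of `n p`, so at least one of the values
      -- of `f₁` is available for `n p`.
      have hno : ∀ w ∈ insert (n a) (P.erase a), w ≠ p → w ≠ b → ¬ G.Adj (n p) w := by
        intro w hw hwp hwb hadj
        rcases hmem w hw with rfl | rfl | rfl | rfl
        · exact h.col _ _ hadj (hnp.trans hq.symm)
        · exact hwp rfl
        · exact h.col _ _ hadj hnp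
        · exact hwb rfl
      by_cases hfb : f₁ b = f₁ p
      · right
        intro w hw hfw
        exact hno w hw (fun e => hfw (e ▸ rfl)) (fun e => hfw (e ▸ hfb))
      · left
        intro w hw hwp hfw
        exact hno w hw hwp (fun e => hfb (e ▸ hfw)))
    refine hr.trans (hr₂.trans (hf₂.kempeRel_of_omits h.col (i := φ p) ?_))
    intro w hw
    rcases Finset.mem_insert.1 hw with rfl | hw
    · rwa [hnp]
    · rcases Finset.mem_erase.1 hw with ⟨hwp, hw⟩
      rcases hmem w hw with rfl | rfl | rfl | rfl
      · rwa [hq]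
      · exact absurd rfl hwp
      · exact hφpq
      · exact hφb
  by_cases hna : φ (n a) = φ u
  · exact key v u (Or.inl ⟨rfl, rfl⟩) hna h.reverse.φnu
  · exact key u v (Or.inr ⟨rfl, rfl⟩) (fin_three_eq h.φu_ne (h.col _ _ h.hav)
      (h.col _ _ h.hvu).symm (h.col _ _ (h.out a ha).2.1).symm hna) h.φnu

/-- If both ends are blocked, `n a` is adjacent to `a` and `u`, so it has colour `φ v`, is not
adjacent to `v` and must be adjacent to `b`. As `a` and `b` share a side, `n a = n b`; but the
obstruction at `b` makes `n b` adjacent to `v`. -/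
theorem kempeRel_of_middle (h : PathCover G s φ P f n a v u b) (hs : s v = s u) :
    KempeRel G (coverColor s P f) (castColor φ) := by
  obtain ⟨ha, hv, hu, hb⟩ := h.mem
  by_cases h1 : ¬ G.Adj (n a) u ∨ (¬ G.Adj (n a) v ∧ ¬ G.Adj (n a) b)
  · exact h.kempeRel_of_middle_of_free hs h1
  by_cases h2 : ¬ G.Adj (n b) v ∨ (¬ G.Adj (n b) u ∧ ¬ G.Adj (n b) a)
  · exact h.reverse.kempeRel_of_middle_of_free hs.symm h2
  exfalso
  rw [not_or, not_not] at h1 h2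
  have hav : s a ≠ s v := fun e => by
    have := h.uniq a ha v hv v hv u hu h.hav e h.hvu hs
    simp only [Sym2.eq_iff] at this
    rcases this with ⟨e, _⟩ | ⟨e, _⟩
    · exact h.hav.ne e
    · exact h.φu_ne (e ▸ rfl)
  have hbu : s b ≠ s u := fun e => by
    have := h.uniq u hu b hb v hv u hu h.hub e.symm h.hvu hs
    simp only [Sym2.eq_iff] at this
    rcases this with ⟨e, _⟩ | ⟨_, e⟩
    · exact h.hvu.ne e.symm
    · exact h.reverse.φu_ne (e ▸ rfl)
  have hsab : s a = s b := bool_eq_of_ne (hs ▸ hav) hbu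
  obtain ⟨o1, o2, o3⟩ := h.out a ha
  have hφ : φ (n a) = φ v := fin_three_eq h.φu_ne (h.col _ _ h.hav) (h.col _ _ h.hvu).symm
    (h.col _ _ o2).symm (h.col _ _ h1.1)
  have hnv : ¬ G.Adj (n a) v := fun hc => h.col _ _ hc hφ
  have hnb : G.Adj (n a) b := by
    by_contra hc
    exact h1.2 ⟨hnv, hc⟩
  have e : n a = n b := (h.unique_out hb (n a)).1 ⟨o1, hnb.symm, hsab.symm.trans o3⟩
  exact hnv (e ▸ h2.1)

end PathCover

end Path

/-- If at most five edges lie inside a side, then some pair of colours appears on none of them. -/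
theorem exists_unused_pair {V : Type*} [Finite V] {G : SimpleGraph V} {s : V → Bool} (c : V → Fin 4)
    (hM : {e : Sym2 V | ∃ u v, e = s(u, v) ∧ G.Adj u v ∧ s u = s v}.ncard ≤ 5) :
    ∃ i j, i ≠ j ∧ ∀ u v, G.Adj u v → s u = s v → ¬ (c u = i ∧ c v = j) := by
  by_contra! hno
  -- Otherwise at most five same-side edges would map onto all six pairs of distinct colours.
  have hsub : (((Finset.univ : Finset (Sym2 (Fin 4))).filter fun e => ¬ e.IsDiag) : Set _) ⊆
      Sym2.map c '' {e : Sym2 V | ∃ u v, e = s(u, v) ∧ G.Adj u v ∧ s u = s v} := by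
    intro e he
    induction e using Sym2.ind with
    | _ i j =>
      have hij : i ≠ j := by simpa using he
      obtain ⟨u, v, huv, hs, rfl, rfl⟩ := hno i j hij
      exact ⟨s(u, v), ⟨u, v, rfl, huv, hs⟩, by simp⟩
  have h1 := Set.ncard_le_ncard hsub (Set.toFinite _)
  have h2 := Set.ncard_image_le (f := Sym2.map c)
    (Set.toFinite {e : Sym2 V | ∃ u v, e = s(u, v) ∧ G.Adj u v ∧ s u = s v})
  rw [Set.ncard_coe_finset] at h1
  have h3 : ((Finset.univ : Finset (Sym2 (Fin 4))).filter fun e => ¬ e.IsDiag).card = 6 := by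
    decide
  omega

/-! ### Four-vertex covers with an inner edge, and the induction on the cover -/

section Main

variable {V : Type*} [DecidableEq V] [Finite V] {G : SimpleGraph V} {s f : V → Bool}
  {φ : V → Fin 3} {P : Finset V}

/-- A four-vertex cover with exactly one edge inside a side leads to the given 3-colouring. -/
theorem IsAdmissible.kempeRel_of_four {a b u v x y : V} {n : V → V}
    (h : IsAdmissible G s P f) (hφ : ∀ u v, G.Adj u v → φ u ≠ φ v) (hP : P = {a, b, u, v})
    (hab : a ≠ b) (hφab : φ a = φ b) (hua : φ u ≠ φ a) (hva : φ v ≠ φ a) (huv : φ u ≠ φ v)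
    (hout : ∀ p ∈ P, n p ∉ P ∧ G.Adj p (n p) ∧ s p = s (n p))
    (hmono : ∀ p q, G.Adj p q → s p = s q →
      (p ∈ P ∧ q = n p) ∨ (q ∈ P ∧ p = n q) ∨ (p ∈ P ∧ q ∈ P))
    (huniq : ∀ p ∈ P, ∀ q ∈ P, ∀ p' ∈ P, ∀ q' ∈ P, G.Adj p q → s p = s q → G.Adj p' q' →
      s p' = s q' → s(p, q) = s(p', q'))
    (hx : x ∈ P) (hy : y ∈ P) (hxy : G.Adj x y) (hsxy : s x = s y) :
    KempeRel G (coverColor s P f) (castColor φ) := by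
  by_contra hneg
  have haP : a ∈ P := by simp [hP]
  have hbP : b ∈ P := by simp [hP]
  have huP : u ∈ P := by simp [hP]
  have hvP : v ∈ P := by simp [hP]
  have hnab : ¬ G.Adj a b := fun hc => hφ _ _ hc hφab
  have hau : a ≠ u := fun e => hua (e ▸ rfl)
  have hav : a ≠ v := fun e => hva (e ▸ rfl)
  have hbu : b ≠ u := fun e => hua (by rw [hφab, e])
  have hbv : b ≠ v := fun e => hva (by rw [hφab, e])
  -- Replacing `p` by `n p` would give a cover omitting `φ p`. If this is blocked, `n p` has
  -- neighbours in both classes of `f'`. They must be `a` and `b`, since adjacency to `q` would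
  -- force the colour `φ a` on `n p`. The freedom in `f'` is what the next steps exploit.
  have F : ∀ f', IsAdmissible G s P f' → ∀ p q, (p = u ∧ q = v) ∨ (p = v ∧ q = u) →
      G.Adj (n p) a ∧ G.Adj (n p) b ∧ f' a ≠ f' b := by
    intro f' hf' p q hpq
    have hp : p ∈ P := by rcases hpq with ⟨rfl, _⟩ | ⟨rfl, _⟩ <;> assumption
    have hpa : φ p ≠ φ a := by rcases hpq with ⟨rfl, _⟩ | ⟨rfl, _⟩ <;> assumption
    have hqa : φ q ≠ φ a := by rcases hpq with ⟨_, rfl⟩ | ⟨_, rfl⟩ <;> assumption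
    have hqp : φ p ≠ φ q := by
      rcases hpq with ⟨rfl, rfl⟩ | ⟨rfl, rfl⟩
      · exact huv
      · exact huv.symm
    have hmem : ∀ w ∈ P, w = a ∨ w = b ∨ w = p ∨ w = q := by
      intro w hw
      rw [hP] at hw
      simp only [Finset.mem_insert, Finset.mem_singleton] at hw
      rcases hpq with ⟨rfl, rfl⟩ | ⟨rfl, rfl⟩ <;> tauto
    obtain ⟨o1, o2, o3⟩ := hout p hp
    by_contra hc
    have hfree : (∀ w ∈ P, w ≠ p → f' w = f' p → ¬ G.Adj (n p) w) ∨
        (∀ w ∈ P, f' w ≠ f' p → ¬ G.Adj (n p) w) := by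
      by_contra hno
      push Not at hno
      obtain ⟨⟨q₁, hq₁, hne₁, hf₁, ha₁⟩, ⟨q₂, hq₂, hf₂, ha₂⟩⟩ := hno
      have hne₂ : q₂ ≠ p := fun e => hf₂ (e ▸ rfl)
      have hf₁₂ : f' q₁ ≠ f' q₂ := fun e => hf₂ (e ▸ hf₁)
      have hnq : G.Adj (n p) q → ¬ G.Adj (n p) a ∧ ¬ G.Adj (n p) b := fun hadj => by
        have := fin_three_eq hqp hpa hqa (hφ _ _ o2).symm (hφ _ _ hadj)
        exact ⟨fun h => hφ _ _ h this, fun h => hφ _ _ h (this.trans hφab)⟩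
      rcases hmem q₁ hq₁ with rfl | rfl | rfl | rfl <;>
      rcases hmem q₂ hq₂ with rfl | rfl | rfl | rfl <;>
      first
        | exact hf₁₂ rfl
        | exact hne₁ rfl
        | exact hne₂ rfl
        | exact hc ⟨ha₁, ha₂, hf₁₂⟩
        | exact hc ⟨ha₂, ha₁, hf₁₂.symm⟩
        | exact (hnq ha₁).1 ha₂
        | exact (hnq ha₁).2 ha₂
        | exact (hnq ha₂).1 ha₁
        | exact (hnq ha₂).2 ha₁
    obtain ⟨f₁, hf₁, hr⟩ := hf'.replace_single hp (y := n p) (by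
      intro w
      constructor
      · rintro ⟨h1, h2, h3⟩
        rcases hmono p w h2 h3 with h4 | h4 | h4
        · exact h4.2
        · exact absurd h4.1 h1
        · exact absurd h4.2 h1
      · rintro rfl
        exact ⟨o1, o2, o3⟩) hfree
    refine hneg ((h.kempeRel_of_twoColoring hf').trans
      (hr.trans (hf₁.kempeRel_of_omits hφ (i := φ p) ?_)))
    intro w hw
    rcases Finset.mem_insert.1 hw with rfl | hw
    · exact (hφ _ _ o2).symm
    · rcases Finset.mem_erase.1 hw with ⟨hwp, hw⟩
      rcases hmem w hw with rfl | rfl | rfl | rfl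
      · exact hpa.symm
      · exact hφab ▸ hpa.symm
      · exact absurd rfl hwp
      · exact hqp.symm
  have hmemP : ∀ w ∈ P, w = a ∨ w = b ∨ w = u ∨ w = v := by
    intro w hw
    simpa [hP] using hw
  have hadj : G.Adj u v := by
    -- Without this edge, `{a, b}` and `{u, v}` would be the classes of a proper 2-colouring,
    -- against `F`.
    by_contra hnuv
    have hf' : IsAdmissible G s P (fun w => decide (w = u ∨ w = v)) := by
      refine ⟨h.cover, fun p hp q hq hpq => ?_⟩
      rcases hmemP p hp with rfl | rfl | rfl | rfl <;>
      rcases hmemP q hq with rfl | rfl | rfl | rfl <;>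
      first
        | exact absurd rfl hpq.ne
        | exact absurd hpq hnab
        | exact absurd hpq.symm hnab
        | exact absurd hpq hnuv
        | exact absurd hpq.symm hnuv
        | simp [hau, hav, hbu, hbv]
    refine (F _ hf' u v (Or.inl ⟨rfl, rfl⟩)).2.2 ?_
    simp [hau, hav, hbu, hbv]
  have hfuv := h.proper u huP v hvP hadj
  obtain ⟨u1, u2, hfab⟩ := F f h u v (Or.inl ⟨rfl, rfl⟩)
  obtain ⟨v1, v2, _⟩ := F f h v u (Or.inr ⟨rfl, rfl⟩)
  -- Such a `c` is isolated within `P`; flipping its value makes `a` and `b` agree, against `F`.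
  have hflip : ∀ c d, c ∈ P → f c = f d → (c = a ∨ c = b) →
      (∀ w ∈ P, G.Adj c w → w = d) → False := by
    intro c d hc hcd hcab hw
    have hcd' : ∀ w ∈ P, ¬ G.Adj c w := by
      intro w hwP hcw
      have := hw w hwP hcw
      subst this
      exact h.proper c hc w hwP hcw hcd
    have hf' : IsAdmissible G s P (fun w => if w = c then !(f c) else f w) := by
      refine ⟨h.cover, fun p hp q hq hpq => ?_⟩
      have hpc : p ≠ c := fun e => hcd' q hq (e ▸ hpq)
      have hqc : q ≠ c := fun e => hcd' p hp (e ▸ hpq.symm)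
      simpa [hpc, hqc] using h.proper p hp q hq hpq
    refine (F _ hf' u v (Or.inl ⟨rfl, rfl⟩)).2.2 ?_
    rcases hcab with rfl | rfl
    · simp only [if_true, hab.symm, if_false]
      revert hfab; cases f c <;> cases f b <;> simp
    · simp only [if_true, hab, if_false]
      revert hfab; cases f c <;> cases f a <;> simp
  have main : ∀ c d, (c = a ∧ d = b) ∨ (c = b ∧ d = a) → f c = f u → f d = f v → False := by
    intro c d hcd hcu hdv
    have hc : c ∈ P := by rcases hcd with ⟨rfl, _⟩ | ⟨rfl, _⟩ <;> assumption
    have hd : d ∈ P := by rcases hcd with ⟨_, rfl⟩ | ⟨_, rfl⟩ <;> assumption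
    have hcab : c = a ∨ c = b := by tauto
    have hdab : d = a ∨ d = b := by tauto
    have hne : c ≠ d := by
      rcases hcd with ⟨rfl, rfl⟩ | ⟨rfl, rfl⟩
      · exact hab
      · exact hab.symm
    have hφcd : φ c = φ d := by
      rcases hcd with ⟨rfl, rfl⟩ | ⟨rfl, rfl⟩
      · exact hφab
      · exact hφab.symm
    have hmem : ∀ w ∈ P, w = c ∨ w = v ∨ w = u ∨ w = d := by
      intro w hw
      have := hmemP w hw
      rcases hcd with ⟨rfl, rfl⟩ | ⟨rfl, rfl⟩ <;> tauto
    have hncd : ¬ G.Adj c d := fun hadj' => hφ _ _ hadj' hφcd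
    have hncu : ¬ G.Adj c u := fun hadj' => h.proper c hc u huP hadj' hcu
    have hndv : ¬ G.Adj d v := fun hadj' => h.proper d hd v hvP hadj' hdv
    have hcv : G.Adj c v := by
      by_contra hncv
      refine hflip c u hc hcu hcab fun w hw hcw => ?_
      rcases hmem w hw with rfl | rfl | rfl | rfl
      · exact absurd rfl hcw.ne
      · exact absurd hcw hncv
      · rfl
      · exact absurd hcw hncd
    have hud : G.Adj u d := by
      by_contra hnud
      refine hflip d v hd hdv hdab fun w hw hdw => ?_
      rcases hmem w hw with rfl | rfl | rfl | rfl
      · exact absurd hdw.symm hncd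
      · rfl
      · exact absurd hdw.symm hnud
      · exact absurd rfl hdw.ne
    have hpath : PathCover G s φ P f n c v u d :=
      { adm := h
        col := hφ
        eq := by
          rw [hP]
          rcases hcd with ⟨rfl, rfl⟩ | ⟨rfl, rfl⟩ <;> ext <;> simp <;> tauto
        hab := hne
        hav := hcv
        hvu := hadj.symm
        hub := hud
        fau := hcu
        fvb := hdv.symm
        φab := hφcd
        out := hout
        mono := hmono
        uniq := huniq
        nua := by rcases hcab with rfl | rfl <;> assumption
        nub := by rcases hdab with rfl | rfl <;> assumption
        nva := by rcases hcab with rfl | rfl <;> assumption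
        nvb := by rcases hdab with rfl | rfl <;> assumption }
    -- The cover induces exactly the path `c v u d`, so the inner edge `xy` is one of its three
    -- edges.
    by_cases e1 : s v = s u
    · exact hneg (hpath.kempeRel_of_middle e1)
    by_cases e2 : s u = s d
    · exact hneg (hpath.kempeRel_of_end e2)
    by_cases e3 : s v = s c
    · exact hneg (hpath.reverse.kempeRel_of_end e3)
    have hyx := hxy.symm
    rcases hmem x hx with rfl | rfl | rfl | rfl <;>
    rcases hmem y hy with rfl | rfl | rfl | rfl <;>
    first
      | exact hxy.ne rfl
      | exact hncd hxy
      | exact hncd hyx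
      | exact hncu hxy
      | exact hncu hyx
      | exact hndv hxy
      | exact hndv hyx
      | exact e1 hsxy
      | exact e1 hsxy.symm
      | exact e2 hsxy
      | exact e2 hsxy.symm
      | exact e3 hsxy
      | exact e3 hsxy.symm
  by_cases hau' : f a = f u
  · exact main a b (Or.inl ⟨rfl, rfl⟩) hau'
      (bool_eq_of_ne (fun e => hfab (hau'.trans e.symm)) hfuv.symm)
  · have hav' : f a = f v := bool_eq_of_ne hau' hfuv.symm
    exact main b a (Or.inr ⟨rfl, rfl⟩)
      (bool_eq_of_ne (fun e => hfab (hav'.trans e.symm)) hfuv) hav'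

/-- If at most five edges lie inside a side, then every cover leads to the given 3-colouring. -/
theorem IsAdmissible.kempeRel_castColor (hφ : ∀ u v, G.Adj u v → φ u ≠ φ v)
    (hM : {e : Sym2 V | ∃ u v, e = s(u, v) ∧ G.Adj u v ∧ s u = s v}.ncard ≤ 5)
    (h : IsAdmissible G s P f) : KempeRel G (coverColor s P f) (castColor φ) := by
  classical
  induction hk : P.card using Nat.strong_induction_on generalizing P f with
  | _ k ih =>
  -- A redundant vertex is dropped by induction; in the other case the cover is minimal.
  by_cases hmin : ∃ p ∈ P, ∀ u v, G.Adj u v → s u = s v → u ∈ P.erase p ∨ v ∈ P.erase p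
  · obtain ⟨p, hp, hcov⟩ := hmin
    have hsmall := h.mono (Finset.erase_subset p P) hcov
    exact (h.kempeRel_of_subset (Finset.erase_subset p P) hsmall).symm.trans
      (ih _ (hk ▸ Finset.card_erase_lt_of_mem hp) hsmall rfl)
  by_cases hcard : P.card ≤ 3
  · exact h.kempeRel_of_card_le_three hφ hcard
  have := Fintype.ofFinite V
  have hout' : ∀ p ∈ P, ∃ w, w ∉ P ∧ G.Adj p w ∧ s p = s w := by
    intro p hp
    by_contra! hno
    refine hmin ⟨p, hp, fun u v huv hs => ?_⟩
    by_contra! hc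
    simp only [Finset.mem_erase, not_and] at hc
    by_cases hu : u ∈ P
    · have hup : u = p := by by_contra hne; exact hc.1 hne hu
      subst hup
      exact hno v (hc.2 huv.ne') huv hs
    · have hv := (h.cover u v huv hs).resolve_left hu
      have hvp : v = p := by by_contra hne; exact hc.2 hne hv
      subst hvp
      exact hno u hu huv.symm hs.symm
  have : Nonempty V := by
    obtain ⟨p, _⟩ := Finset.card_pos.1 (show 0 < P.card by omega)
    exact ⟨p⟩
  choose! n hout using hout'
  let E : Finset (Sym2 V) :=
    Finset.univ.filter fun e => ∃ u v, e = s(u, v) ∧ G.Adj u v ∧ s u = s v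
  have hE : E.card ≤ 5 := by
    rw [← Set.ncard_coe_finset]
    convert hM using 2
    ext; simp [E]
  have hEmem : ∀ u v, G.Adj u v → s u = s v → s(u, v) ∈ E := fun u v h1 h2 => by
    simp only [E, Finset.mem_filter, Finset.mem_univ, true_and]
    exact ⟨u, v, rfl, h1, h2⟩
  -- Each private edge has a single end in `P`, so these edges are distinct and number `P.card`. As
  -- `P` has at least four vertices, at most one same-side edge is left over.
  let E₀ : Finset (Sym2 V) := P.image fun p => s(p, n p)
  have hE₀ : E₀ ⊆ E := by
    intro e he
    obtain ⟨p, hp, rfl⟩ := Finset.mem_image.1 he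
    exact hEmem _ _ (hout p hp).2.1 (hout p hp).2.2
  have hE₀mem : ∀ u v, s(u, v) ∈ E₀ → (u ∈ P ∧ v = n u) ∨ (v ∈ P ∧ u = n v) := by
    intro u v he
    obtain ⟨p, hp, he⟩ := Finset.mem_image.1 he
    rcases Sym2.eq_iff.1 he with ⟨rfl, rfl⟩ | ⟨rfl, rfl⟩
    · exact Or.inl ⟨hp, rfl⟩
    · exact Or.inr ⟨hp, rfl⟩
  have hE₀card : E₀.card = P.card := by
    refine Finset.card_image_of_injOn fun p hp q hq he => ?_
    rcases Sym2.eq_iff.1 he with ⟨e, _⟩ | ⟨e, _⟩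
    · exact e
    · exact absurd (e ▸ hp) (hout q hq).1
  have hdiff : (E \ E₀).card + P.card ≤ 5 := by
    rw [← hE₀card, Finset.card_sdiff_add_card_eq_card hE₀]
    exact hE
  have hone : ∀ e ∈ E \ E₀, ∀ e' ∈ E \ E₀, e = e' :=
    Finset.card_le_one.1 (by omega)
  by_cases hinner : ∃ x ∈ P, ∃ y ∈ P, G.Adj x y ∧ s x = s y
  · obtain ⟨x, hx, y, hy, hxy, hsxy⟩ := hinner
    have hin : ∀ p ∈ P, ∀ q ∈ P, G.Adj p q → s p = s q → s(p, q) ∈ E \ E₀ := by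
      intro p hp q hq hpq hs
      refine Finset.mem_sdiff.2 ⟨hEmem p q hpq hs, fun hc => ?_⟩
      rcases hE₀mem p q hc with ⟨_, e⟩ | ⟨_, e⟩
      · exact (hout p hp).1 (e ▸ hq)
      · exact (hout q hq).1 (e ▸ hp)
    have hpos : 0 < (E \ E₀).card := Finset.card_pos.2 ⟨_, hin x hx y hy hxy hsxy⟩
    have hfour : P.card = 4 := by omega
    have hmono : ∀ p q, G.Adj p q → s p = s q →
        (p ∈ P ∧ q = n p) ∨ (q ∈ P ∧ p = n q) ∨ (p ∈ P ∧ q ∈ P) := by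
      intro p q hpq hs
      by_cases he : s(p, q) ∈ E₀
      · rcases hE₀mem p q he with h1 | h1
        · exact Or.inl h1
        · exact Or.inr (Or.inl h1)
      · have := hone _ (Finset.mem_sdiff.2 ⟨hEmem p q hpq hs, he⟩) _ (hin x hx y hy hxy hsxy)
        rcases Sym2.eq_iff.1 this with ⟨rfl, rfl⟩ | ⟨rfl, rfl⟩
        · exact Or.inr (Or.inr ⟨hx, hy⟩)
        · exact Or.inr (Or.inr ⟨hy, hx⟩)
    obtain ⟨a, ha, b, hb, hab, hφab⟩ := Finset.exists_ne_map_eq_of_card_lt_of_maps_to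
      (s := P) (t := (Finset.univ : Finset (Fin 3))) (f := φ) (by simp [hfour])
      (fun _ _ => Finset.mem_univ _)
    obtain ⟨u, v, huv, he⟩ := Finset.card_eq_two.1
      (show ((P.erase a).erase b).card = 2 by
        rw [Finset.card_erase_of_mem (Finset.mem_erase.2 ⟨hab.symm, hb⟩),
          Finset.card_erase_of_mem ha, hfour])
    have hP : P = {a, b, u, v} := by
      rw [← Finset.insert_erase ha,
        ← Finset.insert_erase (Finset.mem_erase.2 ⟨hab.symm, hb⟩ : b ∈ P.erase a), he]
    have two : ∀ i j, (∀ w ∈ P, φ w = i ∨ φ w = j) →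
        KempeRel G (coverColor s P f) (castColor φ) := fun i j hij => by
      obtain ⟨k, hi, hj⟩ := exists_fin_three_ne i j
      refine h.kempeRel_of_omits hφ (i := k) fun v hv => ?_
      rcases hij v hv with e | e <;> rwa [e]
    by_cases h1 : φ u = φ a
    · exact two (φ a) (φ v) (by simp [hP, h1, hφab])
    by_cases h2 : φ v = φ a
    · exact two (φ a) (φ u) (by simp [hP, h2, hφab])
    by_cases h3 : φ u = φ v
    · exact two (φ a) (φ v) (by simp [hP, h3, hφab])
    exact h.kempeRel_of_four hφ hP hab hφab h1 h2 h3 hout hmono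
      (fun p hp q hq p' hp' q' hq' h1 h2 h3 h4 =>
        hone _ (hin p hp q hq h1 h2) _ (hin p' hp' q' hq' h3 h4)) hx hy hxy hsxy
  -- With no same-side edge inside `P`, the side map is itself a proper 2-colouring of it.
  · have hside : IsAdmissible G s P s :=
      ⟨h.cover, fun u hu v hv huv hs => hinner ⟨u, hu, v, hv, huv, hs⟩⟩
    refine (h.kempeRel_of_twoColoring hside).trans ?_
    have hsplit : ∀ p ∈ P, ∀ w, G.Adj p w → s p = s w → w = n p ∨ s(p, w) ∈ E \ E₀ := by
      intro p hp w hpw hs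
      by_cases he : s(p, w) ∈ E₀
      · rcases hE₀mem p w he with h1 | h1
        · exact Or.inl h1.2
        · exact absurd ⟨p, hp, w, h1.1, hpw, hs⟩ hinner
      · exact Or.inr (Finset.mem_sdiff.2 ⟨hEmem p w hpw hs, he⟩)
    by_cases hex : ∃ p ∈ P, ∃ w, G.Adj p w ∧ s p = s w ∧ s(p, w) ∈ E \ E₀
    · obtain ⟨p, hp, w, hpw, hs, he⟩ := hex
      -- The extra edge `pw` is the only place where consistency could fail, so `i` avoids both `φ
      -- w` and `φ (n p)`.
      obtain ⟨i, hi1, hi2⟩ := exists_fin_three_ne (φ w) (φ (n p))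
      refine hside.kempeRel_of_consistent hφ n (fun p hp => (hout p hp).2.1) i
        fun p' hp' w' hpw' hs' => ?_
      rcases hsplit p' hp' w' hpw' hs' with rfl | he'
      · rfl
      · rcases Sym2.eq_iff.1 (hone _ he' _ he) with ⟨rfl, rfl⟩ | ⟨rfl, rfl⟩
        · exact iff_of_false hi1 hi2
        · exact absurd ⟨_, hp, _, hp', hpw, hs⟩ hinner
    -- Same-side neighbours of cover vertices are now unique, so any colour is consistent; 0 is
    -- arbitrary.
    · refine hside.kempeRel_of_consistent hφ n (fun p hp => (hout p hp).2.1) 0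
        fun p' hp' w' hpw' hs' => ?_
      rcases hsplit p' hp' w' hpw' hs' with rfl | he'
      · rfl
      · exact absurd ⟨p', hp', w', hpw', hs', he'⟩ hex

/-- If at most five edges lie inside a side, then every 4-colouring is Kempe equivalent to the
given 3-colouring. -/
theorem IsProper.kempeRel_castColor {c : V → Fin 4} (hc : IsProper G c)
    (hφ : ∀ u v, G.Adj u v → φ u ≠ φ v)
    (hM : {e : Sym2 V | ∃ u v, e = s(u, v) ∧ G.Adj u v ∧ s u = s v}.ncard ≤ 5) :
    KempeRel G c (castColor φ) := by
  have := Fintype.ofFinite V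
  obtain ⟨i, j, hij, hfree⟩ := exists_unused_pair c hM
  let σ := Equiv.swap i (2 : Fin 4)
  -- The swap uses `σ j` because `σ` moves `j` when `j = 2`.
  let τ := Equiv.swap (σ j) (3 : Fin 4)
  let d : V → Fin 4 := τ ∘ (σ ∘ c)
  have hd : IsProper G d := (hc.comp_perm σ).comp_perm τ
  have hrel : KempeRel G c d := (KempeRel.swap hc _ _).trans (KempeRel.swap (hc.comp_perm σ) _ _)
  have hdec : ∀ i j x : Fin 4, i ≠ j →
      (Equiv.swap (Equiv.swap i 2 j) 3 (Equiv.swap i 2 x) = 2 → x = i) ∧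
      (Equiv.swap (Equiv.swap i 2 j) 3 (Equiv.swap i 2 x) = 3 → x = j) := by decide
  have hd2 : ∀ v, d v = 2 → c v = i := fun v => (hdec i j (c v) hij).1
  have hd3 : ∀ v, d v = 3 → c v = j := fun v => (hdec i j (c v) hij).2
  let P : Finset V := Finset.univ.filter fun v => d v = 0 ∨ d v = 1
  let f : V → Bool := fun v => decide (d v = 1)
  have hPmem : ∀ v, v ∈ P ↔ d v = 0 ∨ d v = 1 := fun v => by simp [P]
  have hfin : ∀ x : Fin 4, ¬ (x = 0 ∨ x = 1) → x = 2 ∨ x = 3 := by decide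
  have hadm : IsAdmissible G s P f := by
    constructor
    · intro u v huv hs
      by_contra! hno
      rw [hPmem, hPmem] at hno
      have hne := hd u v huv
      rcases hfin _ hno.1 with e | e <;> rcases hfin _ hno.2 with e' | e'
      · exact hne (e.trans e'.symm)
      · exact hfree u v huv hs ⟨hd2 u e, hd3 v e'⟩
      · exact hfree v u huv.symm hs.symm ⟨hd2 v e', hd3 u e⟩
      · exact hne (e.trans e'.symm)
    · intro u hu v hv huv
      have hne := hd u v huv
      rcases (hPmem u).1 hu with e | e <;> rcases (hPmem v).1 hv with e' | e' <;>
        simp_all [f]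
  have hlast : KempeRel G d (coverColor s P f) := by
    refine KempeRel.of_differ 2 3 (by decide) hd hadm.isProper fun v hv => ?_
    by_cases hvP : v ∈ P
    · exfalso
      apply hv
      rw [coverColor_of_mem hvP]
      rcases (hPmem v).1 hvP with e | e <;> simp [f, e]
    · rw [coverColor_of_notMem hvP] at hv ⊢
      rcases hfin _ (fun hc => hvP ((hPmem v).2 hc)) with e | e <;> cases hs : s v <;> simp_all
  exact (hrel.trans hlast).trans (hadm.kempeRel_castColor hφ hM)

end Main

end SimpleGraph

theorem theorem2 {V : Type*} [Finite V] (G : SimpleGraph V) (l : ℕ)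
    (hG : G.Colorable 3) (hB : G.IsBipartitePlus l) (hl : l ≤ 5) :
    G.kempeClassCount 4 = 1 := by
  classical
  obtain ⟨φ⟩ := hG
  obtain ⟨B, ⟨b⟩, _, hfin, hcard⟩ := hB
  let s : V → Bool := fun v => decide (b v = 0)
  have hs : ∀ u v, s u = s v → b u = b v := by
    intro u v h
    have key : ∀ x y : Fin 2, decide (x = 0) = decide (y = 0) → x = y := by decide
    exact key _ _ h
  -- Edges of `B` join different sides, so every same-side edge is one of the added edges.
  have hM : {e : Sym2 V | ∃ u v, e = s(u, v) ∧ G.Adj u v ∧ s u = s v}.ncard ≤ 5 := by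
    refine le_trans (Set.ncard_le_ncard ?_ hfin) (hcard.trans_le hl)
    rintro _ ⟨u, v, rfl, huv, h⟩
    exact ⟨huv, fun hc => b.valid hc (hs u v h)⟩
  have hφ : ∀ u v, G.Adj u v → φ u ≠ φ v := fun u v h => φ.valid h
  have hall : ∀ c : G.Coloring (Fin 4), SimpleGraph.KempeRel G c (SimpleGraph.castColor φ) :=
    fun c => SimpleGraph.IsProper.kempeRel_castColor (fun u v h => c.valid h) hφ hM
  rw [SimpleGraph.kempeClassCount, Nat.card_eq_one_iff_unique]
  constructor
  · constructor
    intro x y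
    induction x using Quotient.inductionOn with
    | _ c =>
    induction y using Quotient.inductionOn with
    | _ c' =>
    apply Quotient.sound
    obtain ⟨d, d', h1, h2, h3⟩ := (hall c).trans (hall c').symm
    rw [DFunLike.coe_injective h1, DFunLike.coe_injective h2] at h3
    exact h3
  · exact ⟨Quotient.mk _ (SimpleGraph.Coloring.mk (SimpleGraph.castColor φ)
      fun {u v} h hc => hφ u v h (Fin.castSucc_injective _ hc))⟩
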